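/- For parameters $\alpha\in(0,1)$ and $\beta,\mu,\gamma,\epsilon>0$ consider the nonlinear dynamic system for $u(t)=(x(t),y(t),w(t))\in\mathbb{R}^3$, $t\ge 0$: $$ \begin{cases} x'(t) = -\gamma\, y'(t) - \epsilon\, y(t),\\ y'(t) = \beta x(t) + \tfrac12 \alpha\mu\,(w(t) - |y(t)|),\\ w'(t) = \beta x(t) + \tfrac12(\alpha-2)\mu\,(w(t)-|y(t)|). \end{cases} \qquad (S) $$ It is a switched linear system: $u'=A^+u$ on $\{y\ge 0\}$ and $u'=A^-u$ on $\{y<0\}$, with $$ A^{\pm}=\begin{pmatrix} -\gamma\beta & \pm\tfrac12\gamma\alpha\mu-\epsilon & -\tfrac12\gamma\alpha\mu\\ \beta & \mp\tfrac12\alpha\mu & \tfrac12\alpha\mu\\ \beta & \mp\tfrac12(\alpha-2)\mu & \tfrac12(\alpha-2)\mu \end{pmatrix}. $$ **Theorem.** For all $\beta,\mu>0$ and $\alpha\in(0,1)$ there exist $\gamma>0$ and $\epsilon>0$ satisfying the condition $$ \frac{\beta\gamma^2}{4}<\epsilon<\frac{\beta\gamma^2}{2},\qquad \epsilon>\frac{\beta\gamma^2}{2}-\left(\frac{\alpha\gamma\mu}{2}-\frac{(1-\alpha)\mu^2}{2\beta}\right),\qquad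 \gamma>\frac{(1-\alpha)\mu}{\alpha\beta}. \qquad (C) $$ Moreover, for all $\gamma,\epsilon>0$ satisfying (C): (i) the two linear pieces $u'=A^+u$ and $u'=A^-u$ have a common quadratic Lyapunov function, that is, $A^+$ and $A^-$ are Hurwitz (all their eigenvalues have negative real part) and there is a symmetric positive definite matrix $P$ such that $PA+A^{T}P$ is negative definite for both $A=A^+$ and $A=A^-$; (ii) the system is exponentially stable: there are constants $C,a>0$ such that $\|u(t)\|\le Ce^{-at}\|u(0)\|$ for all $t\ge0$ and every solution $u$ of (S). The same holds (with some $C,a>0$) for every solution of the switched linear system $u'(t)=A(t)u(t)$ under any switching signal $t\mapsto A(t)\in\{A^+,A^-\}$, where a solution is a continuous function satisfying the equation for all $t\ge0$ outside a set of exceptional times that has finitely many points in every bounded interval. -/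

import Mathlib

open scoped Matrix

noncomputable section

namespace SwitchedLinear

variable {n : ℕ}

/-- The vector `A u`, as a vector of Euclidean space. -/
def act (A : Matrix (Fin n) (Fin n) ℝ) (u : EuclideanSpace ℝ (Fin n)) :
    EuclideanSpace ℝ (Fin n) :=
  WithLp.toLp 2 (A *ᵥ u.ofLp)

/-- A real square matrix is Hurwitz if each of its complex eigenvalues has negative real part. -/
def IsHurwitz (A : Matrix (Fin n) (Fin n) ℝ) : Prop :=
  ∀ z : ℂ, Module.End.HasEigenvalue (Matrix.toLin' (A.map (algebraMap ℝ ℂ))) z → z.re < 0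

/-- `V u = uᵀ P u` is a quadratic Lyapunov function for `u' = A u`: `P` is symmetric positive
definite and `P A + Aᵀ P` is (symmetric) negative definite. -/
def IsQLF (A P : Matrix (Fin n) (Fin n) ℝ) : Prop :=
  P.PosDef ∧ (-(P * A + Aᵀ * P)).PosDef

/-- `V u = uᵀ P u` is a common quadratic Lyapunov function for the systems `u' = A u`, `A ∈ 𝒜`,
where all matrices in `𝒜` are Hurwitz. -/
def IsCQLF (𝒜 : Set (Matrix (Fin n) (Fin n) ℝ)) (P : Matrix (Fin n) (Fin n) ℝ) : Prop :=
  (∀ A ∈ 𝒜, IsHurwitz A) ∧ ∀ A ∈ 𝒜, IsQLF A P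

/-- `u` solves `u'(t) = A(t) u(t)` for `t ≥ 0`: it is continuous, and the equation holds except
possibly at a set of switching times having finitely many points in each bounded interval. -/
def IsSwitchedSolution (A : ℝ → Matrix (Fin n) (Fin n) ℝ)
    (u : ℝ → EuclideanSpace ℝ (Fin n)) : Prop :=
  ContinuousOn u (Set.Ici 0) ∧
    ∃ D : Set ℝ, (∀ T : ℝ, (D ∩ Set.Icc 0 T).Finite) ∧
      ∀ t : ℝ, 0 ≤ t → t ∉ D → HasDerivWithinAt u (act (A t) (u t)) (Set.Ici 0) t

/-- The origin is exponentially stable for the switched linear system `u'(t) = A(t) u(t)`,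
`A(t) ∈ 𝒜`, uniformly over all switching signals `t ↦ A(t)`. -/
def SwitchedExponentiallyStable (𝒜 : Set (Matrix (Fin n) (Fin n) ℝ)) : Prop :=
  ∃ C a : ℝ, 0 < C ∧ 0 < a ∧
    ∀ (A : ℝ → Matrix (Fin n) (Fin n) ℝ) (u : ℝ → EuclideanSpace ℝ (Fin n)),
      (∀ t : ℝ, 0 ≤ t → A t ∈ 𝒜) → IsSwitchedSolution A u →
        ∀ t : ℝ, 0 ≤ t → ‖u t‖ ≤ C * Real.exp (-a * t) * ‖u 0‖

/-- `u` solves the autonomous equation `u'(t) = F (u(t))` for `t ≥ 0`. -/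
def IsSolution (F : EuclideanSpace ℝ (Fin n) → EuclideanSpace ℝ (Fin n))
    (u : ℝ → EuclideanSpace ℝ (Fin n)) : Prop :=
  ∀ t : ℝ, 0 ≤ t → HasDerivWithinAt u (F (u t)) (Set.Ici 0) t

/-- The origin is (globally) exponentially stable for `u' = F u`. -/
def ExponentiallyStable (F : EuclideanSpace ℝ (Fin n) → EuclideanSpace ℝ (Fin n)) : Prop :=
  ∃ C a : ℝ, 0 < C ∧ 0 < a ∧
    ∀ u : ℝ → EuclideanSpace ℝ (Fin n), IsSolution F u →
      ∀ t : ℝ, 0 ≤ t → ‖u t‖ ≤ C * Real.exp (-a * t) * ‖u 0‖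

end SwitchedLinear

namespace AgentInvitation

open SwitchedLinear

/-- The value of `y'` at the state `(x, y, w)`. -/
def yRate (α β μ : ℝ) (x y w : ℝ) : ℝ := β * x + 1 / 2 * α * μ * (w - |y|)

/-- The value of `w'` at the state `(x, y, w)`. -/
def wRate (α β μ : ℝ) (x y w : ℝ) : ℝ := β * x + 1 / 2 * (α - 2) * μ * (w - |y|)

/-- The right-hand side of the nonlinear system for `u = (x, y, w)`:
`x' = -γ y' - ε y`, `y' = β x + (1/2) α μ (w - |y|)`, `w' = β x + (1/2) (α - 2) μ (w - |y|)`. -/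
def field (α β μ γ ε : ℝ) (u : EuclideanSpace ℝ (Fin 3)) : EuclideanSpace ℝ (Fin 3) :=
  !₂[-γ * yRate α β μ (u 0) (u 1) (u 2) - ε * u 1,
    yRate α β μ (u 0) (u 1) (u 2),
    wRate α β μ (u 0) (u 1) (u 2)]

/-- The matrix of the linear piece of the system on `y ≥ 0`. -/
def APlus (α β μ γ ε : ℝ) : Matrix (Fin 3) (Fin 3) ℝ :=
  !![-γ * β, 1 / 2 * γ * α * μ - ε, -(1 / 2) * γ * α * μ;
    β, -(1 / 2) * α * μ, 1 / 2 * α * μ;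
    β, -(1 / 2) * (α - 2) * μ, 1 / 2 * (α - 2) * μ]

/-- The matrix of the linear piece of the system on `y < 0`. -/
def AMinus (α β μ γ ε : ℝ) : Matrix (Fin 3) (Fin 3) ℝ :=
  !![-γ * β, -(1 / 2) * γ * α * μ - ε, -(1 / 2) * γ * α * μ;
    β, 1 / 2 * α * μ, 1 / 2 * α * μ;
    β, 1 / 2 * (α - 2) * μ, 1 / 2 * (α - 2) * μ]

/-- On `y ≥ 0` the nonlinear system is the linear system with matrix `APlus`. -/
theorem field_eq_of_nonneg (α β μ γ ε : ℝ) (u : EuclideanSpace ℝ (Fin 3)) (h : 0 ≤ u 1) :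
    field α β μ γ ε u = act (APlus α β μ γ ε) u := by
  ext i
  fin_cases i <;>
    simp [field, act, APlus, yRate, wRate, dotProduct, Fin.sum_univ_three,
      abs_of_nonneg h] <;> ring

/-- On `y < 0` the nonlinear system is the linear system with matrix `AMinus`. -/
theorem field_eq_of_neg (α β μ γ ε : ℝ) (u : EuclideanSpace ℝ (Fin 3)) (h : u 1 < 0) :
    field α β μ γ ε u = act (AMinus α β μ γ ε) u := by
  ext i
  fin_cases i <;>
    simp [field, act, AMinus, yRate, wRate, dotProduct, Fin.sum_univ_three,
      abs_of_neg h] <;> ring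

/-- The sufficient stability condition on the parameters. -/
def StableCond (α β μ γ ε : ℝ) : Prop :=
  (β * γ ^ 2 / 4 < ε ∧ ε < β * γ ^ 2 / 2) ∧
    ε > β * γ ^ 2 / 2 - (α * γ * μ / 2 - (1 - α) * μ ^ 2 / (2 * β)) ∧
    γ > (1 - α) * μ / (α * β)

end AgentInvitation

end

/-! Put z = 2βγx + (αε - 2ε + 2βγ²)y - αεw. Since (x + γy)' = -εy, both linear pieces give z' =
-2βε(x + γy) and z'' = 2βε²y. In the coordinates (z, z', z'') the pieces are therefore companion
matrices that differ only in the coefficient of z'', by the jump σ ∈ {0, αμ}. This is a Lur'e system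
with sector [0, αμ]. With g = βγ and e = βε, spectral factorization in the circle criterion gives an
explicit form `phaseForm`. Its decay along both pieces is a sum of squares with positive weights
when g²/4 < e < g²/2 (`companion_isQLF`), and the form itself is positive definite there
(`phaseForm_posDef`). Pulling it back through `phaseMap` gives a common P for A⁺ and A⁻. The rest is
general Lyapunov theory: such a P forces both matrices to be Hurwitz, and exp(ct/q)·uᵀPu cannot
increase whatever the switching. The nonlinear system is the case where the signal follows the sign
of y. -/

namespace SwitchedLinear

/-! ### Quadratic Lyapunov functions, eigenvalues and decay under switching -/

variable {n : ℕ}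

/-- Quadratic Lyapunov functions are transported by linear intertwining maps. -/
theorem IsQLF.conj {A K Q T : Matrix (Fin n) (Fin n) ℝ} (hQ : IsQLF K Q)
    (hT : Function.Injective T.mulVec) (hTA : T * A = K * T) : IsQLF A (Tᵀ * Q * T) := by
  have h : -(Tᵀ * Q * T * A + Aᵀ * (Tᵀ * Q * T)) = Tᴴ * (-(Q * K + Kᵀ * Q)) * T := by
    have hAT : Aᵀ * Tᵀ = Tᵀ * Kᵀ := by rw [← Matrix.transpose_mul, hTA, Matrix.transpose_mul]
    rw [Matrix.conjTranspose_eq_transpose_of_trivial, Matrix.mul_neg, Matrix.neg_mul,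
      Matrix.mul_add, Matrix.add_mul]
    simp only [Matrix.mul_assoc, hTA]
    rw [← Matrix.mul_assoc Aᵀ, hAT, Matrix.mul_assoc]
  refine ⟨?_, h ▸ hQ.2.conjTranspose_mul_mul_same hT⟩
  simpa only [Matrix.conjTranspose_eq_transpose_of_trivial] using
    hQ.1.conjTranspose_mul_mul_same hT

theorem IsQLF.isSymm {A P : Matrix (Fin n) (Fin n) ℝ} (h : IsQLF A P) : Pᵀ = P := by
  simpa only [Matrix.conjTranspose_eq_transpose_of_trivial] using h.1.isHermitian.eq

theorem neg_lyapunov_dotProduct {A P : Matrix (Fin n) (Fin n) ℝ} (hP : Pᵀ = P) (x : Fin n → ℝ) :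
    x ⬝ᵥ (-(P * A + Aᵀ * P)) *ᵥ x = -(2 * (x ⬝ᵥ P *ᵥ (A *ᵥ x))) := by
  have h : x ⬝ᵥ (Aᵀ * P) *ᵥ x = x ⬝ᵥ P *ᵥ (A *ᵥ x) := by
    rw [← Matrix.mulVec_mulVec, Matrix.dotProduct_mulVec, Matrix.vecMul_transpose,
      Matrix.dotProduct_mulVec, ← Matrix.mulVec_transpose, hP, dotProduct_comm]
  rw [Matrix.neg_mulVec, dotProduct_neg, Matrix.add_mulVec, dotProduct_add, h,
    ← Matrix.mulVec_mulVec]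
  ring

/-- The Lyapunov criterion: a matrix with a quadratic Lyapunov function is Hurwitz. -/
theorem IsQLF.isHurwitz {A P : Matrix (Fin n) (Fin n) ℝ} (h : IsQLF A P) : IsHurwitz A := by
  intro z hz
  obtain ⟨v, hv⟩ := hz.exists_hasEigenvector
  have hAv : (A.map (algebraMap ℝ ℂ)) *ᵥ v = z • v := by simpa using hv.apply_eq_smul
  set x : Fin n → ℝ := fun i => (v i).re with hx
  set y : Fin n → ℝ := fun i => (v i).im with hy
  have hAx : A *ᵥ x = z.re • x - z.im • y := by
    ext i
    have := congrArg Complex.re (congrFun hAv i)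
    simpa [Matrix.mulVec, dotProduct, hx, hy] using this
  have hAy : A *ᵥ y = z.im • x + z.re • y := by
    ext i
    have := congrArg Complex.im (congrFun hAv i)
    simp [Matrix.mulVec, dotProduct, hx, hy] at this ⊢
    linarith
  have hsymm : x ⬝ᵥ P *ᵥ y = y ⬝ᵥ P *ᵥ x := by
    rw [Matrix.dotProduct_mulVec, ← Matrix.mulVec_transpose, h.isSymm, dotProduct_comm]
  have hxy : x ≠ 0 ∨ y ≠ 0 := by
    by_contra! hc
    refine hv.2 (funext fun i => Complex.ext ?_ ?_)
    · exact congrFun hc.1 i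
    · exact congrFun hc.2 i
  have hW := neg_lyapunov_dotProduct (A := A) h.isSymm
  have hWx := hW x
  have hWy := hW y
  rw [hAx, Matrix.mulVec_sub, Matrix.mulVec_smul, Matrix.mulVec_smul, dotProduct_sub,
    dotProduct_smul, dotProduct_smul, smul_eq_mul, smul_eq_mul] at hWx
  rw [hAy, Matrix.mulVec_add, Matrix.mulVec_smul, Matrix.mulVec_smul, dotProduct_add,
    dotProduct_smul, dotProduct_smul, smul_eq_mul, smul_eq_mul] at hWy
  have hP0 : ∀ u : Fin n → ℝ, 0 ≤ u ⬝ᵥ P *ᵥ u := fun u => by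
    simpa using h.1.posSemidef.dotProduct_mulVec_nonneg u
  have hW0 : ∀ u : Fin n → ℝ, 0 ≤ u ⬝ᵥ (-(P * A + Aᵀ * P)) *ᵥ u := fun u => by
    simpa only [star_trivial] using h.2.posSemidef.dotProduct_mulVec_nonneg u
  have hW1 : ∀ u : Fin n → ℝ, u ≠ 0 → 0 < u ⬝ᵥ (-(P * A + Aᵀ * P)) *ᵥ u := fun u hu => by
    simpa only [star_trivial] using h.2.dotProduct_mulVec_pos hu
  -- By symmetry of P the terms in `z.im` cancel when the dissipation at the real and imaginary
  -- parts of the eigenvector is added.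
  have hneg : z.re * (x ⬝ᵥ P *ᵥ x + y ⬝ᵥ P *ᵥ y) < 0 := by
    have : 0 < x ⬝ᵥ (-(P * A + Aᵀ * P)) *ᵥ x + y ⬝ᵥ (-(P * A + Aᵀ * P)) *ᵥ y := by
      rcases hxy with hx0 | hy0
      · exact add_pos_of_pos_of_nonneg (hW1 x hx0) (hW0 y)
      · exact add_pos_of_nonneg_of_pos (hW0 x) (hW1 y hy0)
    rw [hWx, hWy, hsymm] at this
    linarith
  by_contra! hz0
  exact absurd hneg (not_lt.mpr (mul_nonneg hz0 (add_nonneg (hP0 x) (hP0 y))))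

theorem continuous_dotProduct_mulVec (M : Matrix (Fin n) (Fin n) ℝ) :
    Continuous fun u : EuclideanSpace ℝ (Fin n) => u.ofLp ⬝ᵥ M *ᵥ u.ofLp := by
  simp only [dotProduct, Matrix.mulVec]
  fun_prop

theorem dotProduct_mulVec_eq_norm_sq_mul (M : Matrix (Fin n) (Fin n) ℝ)
    {u : EuclideanSpace ℝ (Fin n)} (hu : u ≠ 0) :
    u.ofLp ⬝ᵥ M *ᵥ u.ofLp =
      ‖u‖ ^ 2 * ((‖u‖⁻¹ • u).ofLp ⬝ᵥ M *ᵥ (‖u‖⁻¹ • u).ofLp) := by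
  have : ‖u‖ ≠ 0 := norm_ne_zero_iff.mpr hu
  rw [WithLp.ofLp_smul, Matrix.mulVec_smul, dotProduct_smul, smul_dotProduct, smul_eq_mul,
    smul_eq_mul]
  field_simp

/-- The constant is the minimum of the form on the compact unit sphere, carried to all vectors by
homogeneity. The sphere is empty when n = 0. -/
theorem exists_le_dotProduct_mulVec {M : Matrix (Fin n) (Fin n) ℝ} (hM : M.PosDef) :
    ∃ c : ℝ, 0 < c ∧ ∀ u : EuclideanSpace ℝ (Fin n), c * ‖u‖ ^ 2 ≤ u.ofLp ⬝ᵥ M *ᵥ u.ofLp := by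
  rcases (Metric.sphere (0 : EuclideanSpace ℝ (Fin n)) 1).eq_empty_or_nonempty with he | hne
  · refine ⟨1, one_pos, fun u => ?_⟩
    by_cases hu : u = 0
    · simp [hu]
    · have : ‖u‖⁻¹ • u ∈ Metric.sphere (0 : EuclideanSpace ℝ (Fin n)) 1 := by
        simp [norm_smul, hu]
      simp [he] at this
  obtain ⟨v, hv, hmin⟩ := (isCompact_sphere (0 : EuclideanSpace ℝ (Fin n)) 1).exists_isMinOn hne
    (continuous_dotProduct_mulVec M).continuousOn
  have hv0 : v.ofLp ≠ 0 := by
    rintro h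
    have : v = 0 := by ext i; exact congrFun h i
    simp [this] at hv
  refine ⟨v.ofLp ⬝ᵥ M *ᵥ v.ofLp, by simpa only [star_trivial] using hM.dotProduct_mulVec_pos hv0,
    fun u => ?_⟩
  by_cases hu : u = 0
  · simp [hu]
  rw [dotProduct_mulVec_eq_norm_sq_mul M hu, mul_comm]
  gcongr
  exact hmin (by simp [norm_smul, hu])

theorem exists_dotProduct_mulVec_le (M : Matrix (Fin n) (Fin n) ℝ) :
    ∃ c : ℝ, 0 < c ∧ ∀ u : EuclideanSpace ℝ (Fin n), u.ofLp ⬝ᵥ M *ᵥ u.ofLp ≤ c * ‖u‖ ^ 2 := by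
  obtain ⟨b, hb⟩ := (isCompact_sphere (0 : EuclideanSpace ℝ (Fin n)) 1).bddAbove_image
    (continuous_dotProduct_mulVec M).continuousOn
  -- The bound b may be nonpositive; the maximum with 1 keeps the constant positive.
  refine ⟨max b 1, by positivity, fun u => ?_⟩
  by_cases hu : u = 0
  · simp [hu]
  rw [dotProduct_mulVec_eq_norm_sq_mul M hu, mul_comm]
  gcongr
  exact (hb ⟨_, by simp [norm_smul, hu], rfl⟩).trans (le_max_left _ _)

/-- A continuous function whose derivative is nonpositive off a finite set does not increase. -/
theorem le_of_hasDerivAt_nonpos_off_finset {f f' : ℝ → ℝ} (s : Finset ℝ) :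
    ∀ {a b : ℝ}, a ≤ b → ContinuousOn f (Set.Icc a b) →
      (∀ t ∈ Set.Ioo a b, t ∉ s → HasDerivAt f (f' t) t ∧ f' t ≤ 0) → f b ≤ f a := by
  induction s using Finset.induction_on with
  | empty =>
    intro a b hab hf hd
    refine antitoneOn_of_deriv_nonpos (convex_Icc a b) hf ?_ ?_ (Set.left_mem_Icc.2 hab)
      (Set.right_mem_Icc.2 hab) hab
    · rw [interior_Icc]
      exact fun t ht => (hd t ht (by simp)).1.differentiableAt.differentiableWithinAt
    · rw [interior_Icc]
      exact fun t ht => (hd t ht (by simp)).1.deriv ▸ (hd t ht (by simp)).2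
  | insert d s _ ih =>
    intro a b hab hf hd
    by_cases h : d ∈ Set.Ioo a b
    · refine (ih h.2.le (hf.mono (Set.Icc_subset_Icc_left h.1.le)) fun t ht hts => ?_).trans
        (ih h.1.le (hf.mono (Set.Icc_subset_Icc_right h.2.le)) fun t ht hts => ?_)
      · exact hd t ⟨h.1.trans ht.1, ht.2⟩ (by simp [hts, ht.1.ne'])
      · exact hd t ⟨ht.1, ht.2.trans h.2⟩ (by simp [hts, ht.2.ne])
    · refine ih hab hf fun t ht hts => hd t ht ?_
      simp only [Finset.mem_insert, not_or]
      exact ⟨fun htd => h (htd ▸ ht), hts⟩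

theorem hasDerivAt_dotProduct_mulVec {P : Matrix (Fin n) (Fin n) ℝ} (hP : Pᵀ = P)
    {u : ℝ → EuclideanSpace ℝ (Fin n)} {u' : EuclideanSpace ℝ (Fin n)} {t : ℝ}
    (hu : HasDerivAt u u' t) :
    HasDerivAt (fun s => (u s).ofLp ⬝ᵥ P *ᵥ (u s).ofLp)
      (2 * ((u t).ofLp ⬝ᵥ P *ᵥ u'.ofLp)) t := by
  have hi : ∀ i, HasDerivAt (fun s => u s i) (u' i) t := fun i =>
    (hasDerivAt_pi.mp ((EuclideanSpace.equiv (Fin n) ℝ).hasFDerivAt.comp_hasDerivAt t hu)) i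
  have h : HasDerivAt (fun s => (u s).ofLp ⬝ᵥ P *ᵥ (u s).ofLp)
      (u'.ofLp ⬝ᵥ P *ᵥ (u t).ofLp + (u t).ofLp ⬝ᵥ P *ᵥ u'.ofLp) t := by
    simp only [dotProduct, Matrix.mulVec, ← Finset.sum_add_distrib]
    exact HasDerivAt.fun_sum fun i _ => (hi i).mul
      (HasDerivAt.fun_sum fun j _ => (hi j).const_mul (P i j))
  convert h using 1
  rw [Matrix.dotProduct_mulVec u'.ofLp, ← Matrix.mulVec_transpose, hP, dotProduct_comm]
  ring

/-- A common quadratic Lyapunov function with a uniform rate of decay gives exponential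
stability under arbitrary switching. -/
theorem IsCQLF.switchedExponentiallyStable {𝒜 : Set (Matrix (Fin n) (Fin n) ℝ)}
    (h𝒜 : 𝒜.Finite) {P : Matrix (Fin n) (Fin n) ℝ} (h : IsCQLF 𝒜 P) :
    SwitchedExponentiallyStable 𝒜 := by
  rcases 𝒜.eq_empty_or_nonempty with rfl | ⟨A₀, hA₀⟩
  · exact ⟨1, 1, one_pos, one_pos, fun A u hA => absurd (hA 0 le_rfl) (by simp)⟩
  have hsymm := (h.2 A₀ hA₀).isSymm
  obtain ⟨p, hp, hPp⟩ := exists_le_dotProduct_mulVec (h.2 A₀ hA₀).1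
  obtain ⟨q, hq, hPq⟩ := exists_dotProduct_mulVec_le P
  obtain ⟨c, hc, hW⟩ : ∃ c : ℝ, 0 < c ∧ ∀ A ∈ 𝒜, ∀ u : EuclideanSpace ℝ (Fin n),
      c * ‖u‖ ^ 2 ≤ u.ofLp ⬝ᵥ (-(P * A + Aᵀ * P)) *ᵥ u.ofLp := by
    choose! c hc0 hc using fun A hA => exists_le_dotProduct_mulVec (h.2 A hA).2
    obtain ⟨B, hB, hmin⟩ := Set.exists_min_image 𝒜 c h𝒜 ⟨A₀, hA₀⟩
    refine ⟨c B, hc0 B hB, fun A hA u => le_trans ?_ (hc A hA u)⟩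
    gcongr
    exact hmin A hA
  -- From p‖u‖² ≤ V ≤ q‖u‖² and V' ≤ -c‖u‖² ≤ -(c/q)V, the form V decays at rate c/q. Taking square
  -- roots halves the rate and gives the factor √(q/p).
  refine ⟨√(q / p), c / (2 * q), by positivity, by positivity, fun A u hA hu t ht => ?_⟩
  obtain ⟨hcont, D, hD, hder⟩ := hu
  have hVcont : ContinuousOn
      (fun s => Real.exp (c / q * s) * ((u s).ofLp ⬝ᵥ P *ᵥ (u s).ofLp)) (Set.Icc 0 t) :=
    (by fun_prop : Continuous fun s => Real.exp (c / q * s)).continuousOn.mul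
      ((continuous_dotProduct_mulVec P).comp_continuousOn
        (hcont.mono Set.Icc_subset_Ici_self))
  have key : Real.exp (c / q * t) * ((u t).ofLp ⬝ᵥ P *ᵥ (u t).ofLp) ≤
      (u 0).ofLp ⬝ᵥ P *ᵥ (u 0).ofLp := by
    have := le_of_hasDerivAt_nonpos_off_finset (hD t).toFinset ht hVcont
      (f' := fun s => Real.exp (c / q * s) * (c / q) * ((u s).ofLp ⬝ᵥ P *ᵥ (u s).ofLp) +
        Real.exp (c / q * s) * (2 * ((u s).ofLp ⬝ᵥ P *ᵥ (act (A s) (u s)).ofLp)))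
      fun s hs hsD => ?_
    · simpa using this
    have hs0 : 0 ≤ s := hs.1.le
    have hsD' : s ∉ D := fun hsD' => hsD (by simpa using ⟨hsD', hs0, hs.2.le⟩)
    constructor
    · have he : HasDerivAt (fun s => Real.exp (c / q * s)) (Real.exp (c / q * s) * (c / q)) s := by
        simpa using ((hasDerivAt_id s).const_mul (c / q)).exp
      exact he.mul (hasDerivAt_dotProduct_mulVec hsymm
        ((hder s hs0 hsD').hasDerivAt (Ici_mem_nhds hs.1)))
    · have h1 := hW (A s) (hA s hs0) (u s)
      rw [neg_lyapunov_dotProduct hsymm] at h1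
      have h2 : c / q * ((u s).ofLp ⬝ᵥ P *ᵥ (u s).ofLp) ≤ c * ‖u s‖ ^ 2 := by
        calc _ ≤ c / q * (q * ‖u s‖ ^ 2) := by gcongr; exact hPq _
          _ = _ := by field_simp
      rw [mul_assoc, ← mul_add]
      refine mul_nonpos_of_nonneg_of_nonpos (Real.exp_pos _).le ?_
      simp only [act]
      linarith
  have h1 : ‖u t‖ ^ 2 ≤ (√(q / p) * Real.exp (-(c / (2 * q)) * t) * ‖u 0‖) ^ 2 := by
    have hexp : Real.exp (-(c / (2 * q)) * t) ^ 2 = (Real.exp (c / q * t))⁻¹ := by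
      rw [← Real.exp_nat_mul, ← Real.exp_neg]
      congr 1
      push_cast
      field_simp
    rw [mul_pow, mul_pow, Real.sq_sqrt (by positivity), hexp]
    have hE := Real.exp_pos (c / q * t)
    have h3 : Real.exp (c / q * t) * (p * ‖u t‖ ^ 2) ≤ q * ‖u 0‖ ^ 2 :=
      (mul_le_mul_of_nonneg_left (hPp _) hE.le).trans (key.trans (hPq _))
    rw [show q / p * (Real.exp (c / q * t))⁻¹ * ‖u 0‖ ^ 2 =
      q * ‖u 0‖ ^ 2 / (Real.exp (c / q * t) * p) by field_simp, le_div_iff₀ (by positivity)]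
    linarith
  exact le_of_sq_le_sq h1 (by positivity)

end SwitchedLinear

/-! ### Companion coordinates and the explicit common Lyapunov form -/

namespace AgentInvitation

open SwitchedLinear

/-- The coordinates, a function with its first two derivatives, up to a scalar, in which both linear pieces are companion
matrices. -/
def phaseMap (α β γ ε : ℝ) : Matrix (Fin 3) (Fin 3) ℝ :=
  !![2 * β * γ, α * ε - 2 * ε + 2 * β * γ ^ 2, -α * ε;
    -2 * β * ε, -2 * β * ε * γ, 0;
    0, 2 * β * ε ^ 2, 0]

/-- The companion matrix of `(X + μ) (X² + g X + e) - σ X²`. -/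
def companion (μ g e σ : ℝ) : Matrix (Fin 3) (Fin 3) ℝ :=
  !![0, 1, 0; 0, 0, 1; -(μ * e), -(μ * g + e), -(μ + g - σ)]

/-- The quadratic form obtained by spectral factorization of the circle criterion. -/
noncomputable def phaseForm (α μ g e : ℝ) : Matrix (Fin 3) (Fin 3) ℝ :=
  !![μ * e * (μ * g + e), μ * e * (2 * g + (2 - α) * μ) / 2, μ * e;
    μ * e * (2 * g + (2 - α) * μ) / 2, (μ * g + e) * (2 * g + (2 - α) * μ) / 2 - μ * e,
      (2 * (μ * g + e) - α * μ * g) / 2;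
    μ * e, (2 * (μ * g + e) - α * μ * g) / 2, (2 * g + (2 - α) * μ) / 2]

theorem phaseMap_mul_APlus (α β μ γ ε : ℝ) :
    phaseMap α β γ ε * APlus α β μ γ ε =
      companion μ (β * γ) (β * ε) 0 * phaseMap α β γ ε := by
  ext i j
  fin_cases i <;> fin_cases j <;>
    simp [phaseMap, APlus, companion, Matrix.mul_apply, Fin.sum_univ_three] <;> ring

theorem phaseMap_mul_AMinus (α β μ γ ε : ℝ) :
    phaseMap α β γ ε * AMinus α β μ γ ε =
      companion μ (β * γ) (β * ε) (α * μ) * phaseMap α β γ ε := by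
  ext i j
  fin_cases i <;> fin_cases j <;>
    simp [phaseMap, AMinus, companion, Matrix.mul_apply, Fin.sum_univ_three] <;> ring

/-- The matrix is triangular up to a reordering: the last row determines y, then the middle row x,
then the first row w. -/
theorem phaseMap_mulVec_injective {α β γ ε : ℝ} (hα : α ≠ 0) (hβ : β ≠ 0) (hε : ε ≠ 0) :
    Function.Injective (phaseMap α β γ ε).mulVec := by
  refine (injective_iff_map_eq_zero (phaseMap α β γ ε).mulVecLin).mpr fun v hv => ?_
  have h0 := congrFun hv 0
  have h1 := congrFun hv 1
  have h2 := congrFun hv 2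
  simp [phaseMap, Matrix.mulVec, dotProduct, Fin.sum_univ_three, hβ, hε] at h0 h1 h2
  simp [h2, hβ, hε] at h1
  simp [h1, h2, hα, hε] at h0
  ext i
  fin_cases i <;> simp [h0, h1, h2]

/-- A, B, C are the entries of the Schur complement of the top left entry of `phaseForm`, scaled by
4a₁; here g stands for half the damping and e = g²(1 + b). Expanded in powers of g and μ, both A and
AC - B² have coefficients that are positive for α and b in (0, 1). -/
theorem phaseForm_minors_pos {α μ g b : ℝ} (hα0 : 0 < α) (hα1 : α < 1) (hμ : 0 < μ) (hg : 0 < g)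
    (hb0 : 0 < b) (hb1 : b < 1) {a₁ a₀ S A B C : ℝ}
    (ha₁ : a₁ = μ * (2 * g) + g ^ 2 * (1 + b)) (ha₀ : a₀ = μ * (g ^ 2 * (1 + b)))
    (hS : S = 2 * (2 * g) + (2 - α) * μ)
    (hC : C = 2 * S * a₁ - 4 * a₀) (hA : A = a₁ * C - a₀ * S ^ 2)
    (hB : B = 4 * a₁ ^ 2 - 2 * α * (2 * g) * μ * a₁ - 2 * a₀ * S) :
    0 < A ∧ B ^ 2 < A * C := by
  have hαb : 0 < α * b := by positivity
  have h1 : 0 < (1 - α) * (1 - b) := mul_pos (by linarith) (by linarith)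
  have h2 : 0 < α * (1 - b) := mul_pos hα0 (by linarith)
  have h3 : 0 < (1 - α) * b := mul_pos (by linarith) hb0
  constructor
  · have e : A = g ^ 2 * μ ^ 3 * (12 - 4 * α - 4 * b + 4 * (b * α) - b * α ^ 2 - α ^ 2)
        + g ^ 3 * μ ^ 2 * (24 - 8 * b)
        + g ^ 4 * μ * (16 * b + 16 - 2 * b ^ 2 * α - 4 * b * α - 2 * α)
        + g ^ 5 * (8 * b ^ 2 + 16 * b + 8) := by subst_vars; ring
    have c1 : 0 < 12 - 4 * α - 4 * b + 4 * (b * α) - b * α ^ 2 - α ^ 2 := by nlinarith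
    have c2 : 0 < 24 - 8 * b := by linarith
    have c3 : 0 < 16 * b + 16 - 2 * b ^ 2 * α - 4 * b * α - 2 * α := by nlinarith
    rw [e]; positivity
  · have e : A * C - B ^ 2 =
        g ^ 3 * μ ^ 5 * (96 - 80 * α + 8 * α ^ 2 - 32 * b + 48 * b * α - 24 * b * α ^ 2
          + 4 * b * α ^ 3 + 4 * α ^ 3)
        + g ^ 4 * μ ^ 4 * (240 - 40 * α - 16 * b * α + 8 * b * α ^ 2 - 44 * α ^ 2 - 32 * b
          + 24 * b ^ 2 * α - 12 * b ^ 2 * α ^ 2 + 2 * b ^ 2 * α ^ 3 + 4 * b * α ^ 3 + 2 * α ^ 3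
          - 16 * b ^ 2)
        + g ^ 5 * μ ^ 3 * (416 + 32 * α - 64 * b - 32 * b ^ 2 * α + 32 * b ^ 2 - 32 * b * α ^ 2
          - 48 * α ^ 2 + 16 * b ^ 2 * α ^ 2)
        + g ^ 6 * μ ^ 2 * (224 * b + 352 - 16 * b ^ 2 * α + 16 * b * α + 16 * α
          + 4 * b ^ 3 * α ^ 2 - 4 * b ^ 2 * α ^ 2 - 20 * b * α ^ 2 - 12 * α ^ 2 - 96 * b ^ 2
          + 32 * b ^ 3 - 16 * b ^ 3 * α)
        + g ^ 7 * μ * (64 * b ^ 2 + 320 * b + 192 - 64 * b ^ 3)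
        + g ^ 8 * (96 * b ^ 2 + 128 * b + 48 - 16 * b ^ 4) := by subst_vars; ring
    have hb2 : b ^ 2 < 1 := pow_lt_one₀ hb0.le hb1 two_ne_zero
    have hb3 : b ^ 3 < 1 := pow_lt_one₀ hb0.le hb1 three_ne_zero
    have hb4 : b ^ 4 < 1 := pow_lt_one₀ hb0.le hb1 four_ne_zero
    have ha2 : α ^ 2 < 1 := pow_lt_one₀ hα0.le hα1 two_ne_zero
    have c1 : 0 < 96 - 80 * α + 8 * α ^ 2 - 32 * b + 48 * b * α - 24 * b * α ^ 2
          + 4 * b * α ^ 3 + 4 * α ^ 3 := by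
      -- The coefficient is affine in b, so positivity at b = 0 and b = 1 suffices.
      have : 96 - 80 * α + 8 * α ^ 2 - 32 * b + 48 * b * α - 24 * b * α ^ 2
          + 4 * b * α ^ 3 + 4 * α ^ 3 = (1 - b) * (96 - 80 * α + 8 * α ^ 2 + 4 * α ^ 3)
            + b * (64 - 32 * α - 16 * α ^ 2 + 8 * α ^ 3) := by ring
      have k1 : 0 < 96 - 80 * α + 8 * α ^ 2 + 4 * α ^ 3 := by
        linarith [pow_pos hα0 3, pow_pos hα0 2]
      have k2 : 0 < 64 - 32 * α - 16 * α ^ 2 + 8 * α ^ 3 := by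
        linarith [pow_pos hα0 3]
      have := mul_pos (sub_pos.2 hb1) k1
      have := mul_pos hb0 k2
      linarith
    have c2 : 0 < 240 - 40 * α - 16 * b * α + 8 * b * α ^ 2 - 44 * α ^ 2 - 32 * b
          + 24 * b ^ 2 * α - 12 * b ^ 2 * α ^ 2 + 2 * b ^ 2 * α ^ 3 + 4 * b * α ^ 3 + 2 * α ^ 3
          - 16 * b ^ 2 := by
      have k1 : b * α < 1 := mul_lt_one_of_nonneg_of_lt_one_left hb0.le hb1 hα1.le
      have k2 : b ^ 2 * α ^ 2 < 1 := mul_lt_one_of_nonneg_of_lt_one_left (by positivity) hb2 ha2.le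
      have : 0 < b * α ^ 2 := by positivity
      have : 0 < b ^ 2 * α := by positivity
      have : 0 < b ^ 2 * α ^ 3 := by positivity
      have : 0 < b * α ^ 3 := by positivity
      have : 0 < α ^ 3 := by positivity
      linarith
    have c3 : 0 < 416 + 32 * α - 64 * b - 32 * b ^ 2 * α + 32 * b ^ 2 - 32 * b * α ^ 2
          - 48 * α ^ 2 + 16 * b ^ 2 * α ^ 2 := by
      have k1 : b ^ 2 * α < 1 := mul_lt_one_of_nonneg_of_lt_one_left (by positivity) hb2 hα1.le
      have k2 : b * α ^ 2 < 1 := mul_lt_one_of_nonneg_of_lt_one_left hb0.le hb1 ha2.le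
      have : 0 < b ^ 2 * α ^ 2 := by positivity
      have : 0 < b ^ 2 := by positivity
      linarith
    have c4 : 0 < 224 * b + 352 - 16 * b ^ 2 * α + 16 * b * α + 16 * α
          + 4 * b ^ 3 * α ^ 2 - 4 * b ^ 2 * α ^ 2 - 20 * b * α ^ 2 - 12 * α ^ 2 - 96 * b ^ 2
          + 32 * b ^ 3 - 16 * b ^ 3 * α := by
      have k1 : b ^ 2 * α < 1 := mul_lt_one_of_nonneg_of_lt_one_left (by positivity) hb2 hα1.le
      have k2 : b * α ^ 2 < 1 := mul_lt_one_of_nonneg_of_lt_one_left hb0.le hb1 ha2.le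
      have k3 : b ^ 2 * α ^ 2 < 1 := mul_lt_one_of_nonneg_of_lt_one_left (by positivity) hb2 ha2.le
      have k4 : b ^ 3 * α < 1 := mul_lt_one_of_nonneg_of_lt_one_left (by positivity) hb3 hα1.le
      have : 0 < b ^ 3 * α ^ 2 := by positivity
      have : 0 < b ^ 3 := by positivity
      linarith
    have c5 : 0 < 64 * b ^ 2 + 320 * b + 192 - 64 * b ^ 3 := by linarith [pow_pos hb0 2]
    have c6 : 0 < 96 * b ^ 2 + 128 * b + 48 - 16 * b ^ 4 := by linarith [pow_pos hb0 2]
    rw [← sub_pos, e]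
    positivity

theorem phaseForm_posDef {α μ g e : ℝ} (hα0 : 0 < α) (hα1 : α < 1) (hμ : 0 < μ) (hg : 0 < g)
    (he1 : g ^ 2 / 4 < e) (he2 : e < g ^ 2 / 2) : (phaseForm α μ g e).PosDef := by
  have he : 0 < e := lt_trans (by positivity) he1
  have hg2 : 0 < g ^ 2 := by positivity
  -- This rescales the window g²/4 < e < g²/2 to 0 < b < 1.
  obtain ⟨b, hb⟩ : ∃ b, b = 4 * e / g ^ 2 - 1 := ⟨_, rfl⟩
  have heb : e = (g / 2) ^ 2 * (1 + b) := by rw [hb]; field_simp; ring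
  obtain ⟨hA, hAC⟩ := phaseForm_minors_pos (g := g / 2) (b := b) hα0 hα1 hμ (by positivity)
    (by rw [hb, sub_pos, lt_div_iff₀ hg2]; linarith)
    (by rw [hb, sub_lt_iff_lt_add, div_lt_iff₀ hg2]; linarith) rfl rfl rfl rfl rfl rfl
  rw [← heb, show 2 * (g / 2) = g by ring] at hA hAC
  set a₁ := μ * g + e with ha₁
  set a₀ := μ * e with ha₀
  set S := 2 * g + (2 - α) * μ with hS
  set C := 2 * S * a₁ - 4 * a₀ with hC
  set A := a₁ * C - a₀ * S ^ 2 with hAdef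
  set B := 4 * a₁ ^ 2 - 2 * α * g * μ * a₁ - 2 * a₀ * S with hBdef
  have ha₁p : 0 < a₁ := by positivity
  have ha₀p : 0 < a₀ := by positivity
  refine Matrix.PosDef.of_dotProduct_mulVec_pos ?_ fun x hx => ?_
  · ext i j
    fin_cases i <;> fin_cases j <;> simp [phaseForm]
  -- Squares are completed in x₀ and then in x₁, with denominators cleared.
  have hq : 4 * a₁ * A * (star x ⬝ᵥ phaseForm α μ g e *ᵥ x) =
      A * a₀ * (2 * a₁ * x 0 + S * x 1 + 2 * x 2) ^ 2 + (A * x 1 + B * x 2) ^ 2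
        + (A * C - B ^ 2) * x 2 ^ 2 := by
    simp only [phaseForm, dotProduct, Matrix.mulVec, Fin.sum_univ_three, star_trivial,
      Matrix.of_apply, Matrix.cons_val]
    rw [hAdef, hBdef, hC, ha₁, ha₀, hS]
    ring
  have hD : 0 < A * C - B ^ 2 := sub_pos.2 hAC
  have hpos : 0 < A * a₀ * (2 * a₁ * x 0 + S * x 1 + 2 * x 2) ^ 2 + (A * x 1 + B * x 2) ^ 2
        + (A * C - B ^ 2) * x 2 ^ 2 := by
    refine lt_of_le_of_ne (by positivity) fun h0 => hx ?_
    have t1 : 0 ≤ A * a₀ * (2 * a₁ * x 0 + S * x 1 + 2 * x 2) ^ 2 := by positivity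
    have t2 : 0 ≤ (A * x 1 + B * x 2) ^ 2 := by positivity
    have t3 : 0 ≤ (A * C - B ^ 2) * x 2 ^ 2 := by positivity
    have e3 : (A * C - B ^ 2) * x 2 ^ 2 = 0 := by linarith
    have e2 : (A * x 1 + B * x 2) ^ 2 = 0 := by linarith
    have e1 : A * a₀ * (2 * a₁ * x 0 + S * x 1 + 2 * x 2) ^ 2 = 0 := by linarith
    have z2 : x 2 = 0 := by simpa [hD.ne'] using e3
    have z1 : x 1 = 0 := by simpa [z2, hA.ne'] using e2
    have z0 : x 0 = 0 := by simpa [z2, z1, hA.ne', ha₀p.ne', ha₁p.ne'] using e1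
    ext i
    fin_cases i <;> simp [z0, z1, z2]
  rw [← hq] at hpos
  exact pos_of_mul_pos_right hpos (by positivity)

/-- The dissipation is one sum of squares for both values of σ. With xₖ replaced by (iω)ᵏ it becomes
the circle criterion polynomial Re(d̄(d + αμω²)), where d is (X + μ)(X² + gX + e) at iω. The upper
bound on e makes the weight of x₂² positive; both bounds serve for that of x₁². -/
theorem companion_isQLF {α μ g e σ : ℝ} (hα0 : 0 < α) (hα1 : α < 1) (hμ : 0 < μ) (hg : 0 < g)
    (he1 : g ^ 2 / 4 < e) (he2 : e < g ^ 2 / 2) (hσ : σ = 0 ∨ σ = α * μ) :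
    IsQLF (companion μ g e σ) (phaseForm α μ g e) := by
  have he : 0 < e := lt_trans (by positivity) he1
  refine ⟨phaseForm_posDef hα0 hα1 hμ hg he1 he2,
    Matrix.PosDef.of_dotProduct_mulVec_pos ?_ fun x hx => ?_⟩
  · ext i j
    fin_cases i <;> fin_cases j <;>
      simp [phaseForm, companion, Matrix.mul_apply, Fin.sum_univ_three] <;> ring
  -- y is the last coordinate of the companion matrix applied to x, that is, the third derivative.
  -- All dependence on σ is absorbed in it, up to the term x₂²σ(αμ - σ), which vanishes at both ends
  -- of the sector.
  obtain ⟨y, hy⟩ : ∃ y, y = -(μ * e) * x 0 - (μ * g + e) * x 1 - (μ + g - σ) * x 2 := ⟨_, rfl⟩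
  have hσ2 : σ * (σ - α * μ) = 0 := by rcases hσ with h | h <;> simp [h]
  have hq : star x ⬝ᵥ (-(phaseForm α μ g e * companion μ g e σ
        + (companion μ g e σ)ᵀ * phaseForm α μ g e)) *ᵥ x =
      (y + α * μ * g / 2 * x 1) ^ 2 + ((1 - α) * μ ^ 2 + (g ^ 2 - 2 * e)) * x 2 ^ 2
        + (e ^ 2 + μ ^ 2 * (g ^ 2 - 2 * e) + α * μ ^ 2 * (e - α * g ^ 2 / 4)) * x 1 ^ 2
        + (μ * e) ^ 2 * x 0 ^ 2 := by
    simp [phaseForm, companion, dotProduct, Matrix.mulVec, Matrix.mul_apply, Fin.sum_univ_three]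
    rw [hy]
    linear_combination (-x 2 ^ 2) * hσ2
  rw [hq]
  have k1 : 0 < (1 - α) * μ ^ 2 + (g ^ 2 - 2 * e) :=
    add_pos (mul_pos (by linarith) (by positivity)) (by linarith)
  have k2 : 0 < e ^ 2 + μ ^ 2 * (g ^ 2 - 2 * e) + α * μ ^ 2 * (e - α * g ^ 2 / 4) := by
    have h1 : 0 < g ^ 2 - 2 * e := by linarith
    have h2 : 0 < e - α * g ^ 2 / 4 := by nlinarith [sq_nonneg g]
    positivity
  refine lt_of_le_of_ne (by positivity) fun h0 => hx ?_
  have t0 : 0 ≤ (y + α * μ * g / 2 * x 1) ^ 2 := by positivity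
  have t1 : 0 ≤ ((1 - α) * μ ^ 2 + (g ^ 2 - 2 * e)) * x 2 ^ 2 := by positivity
  have t2 : 0 ≤ (e ^ 2 + μ ^ 2 * (g ^ 2 - 2 * e) + α * μ ^ 2 * (e - α * g ^ 2 / 4)) * x 1 ^ 2 := by
    positivity
  have t3 : 0 ≤ (μ * e) ^ 2 * x 0 ^ 2 := by positivity
  have e1 : ((1 - α) * μ ^ 2 + (g ^ 2 - 2 * e)) * x 2 ^ 2 = 0 := by linarith
  have e2 : (e ^ 2 + μ ^ 2 * (g ^ 2 - 2 * e) + α * μ ^ 2 * (e - α * g ^ 2 / 4)) * x 1 ^ 2 = 0 := by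
    linarith
  have e3 : (μ * e) ^ 2 * x 0 ^ 2 = 0 := by linarith
  have z2 : x 2 = 0 := by simpa [k1.ne'] using e1
  have z1 : x 1 = 0 := by simpa [k2.ne'] using e2
  have z0 : x 0 = 0 := by simpa [hμ.ne', he.ne'] using e3
  ext i
  fin_cases i <;> simp [z0, z1, z2]

/-! ### Admissible parameters and the common P in the original coordinates -/

theorem exists_stableCond {α β μ : ℝ} (hβ : 0 < β) (hμ : 0 < μ) (hα0 : 0 < α) :
    ∃ γ ε : ℝ, 0 < γ ∧ 0 < ε ∧ StableCond α β μ γ ε := by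
  obtain ⟨γ, hγ⟩ := exists_gt (max 0 ((1 - α) * μ / (α * β)))
  obtain ⟨hγ0, hγ1⟩ := max_lt_iff.mp hγ
  -- The lower bound on γ says exactly that this bracket is positive, so both lower bounds for ε lie
  -- below βγ²/2.
  have hd : 0 < α * γ * μ / 2 - (1 - α) * μ ^ 2 / (2 * β) := by
    rw [div_lt_iff₀ (by positivity)] at hγ1
    rw [sub_pos, div_lt_div_iff₀ (by positivity) two_pos]
    nlinarith
  have hβγ : 0 < β * γ ^ 2 := by positivity
  obtain ⟨ε, hε1, hε2⟩ := exists_between (a₁ := max (β * γ ^ 2 / 4)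
    (β * γ ^ 2 / 2 - (α * γ * μ / 2 - (1 - α) * μ ^ 2 / (2 * β)))) (a₂ := β * γ ^ 2 / 2)
    (max_lt (by linarith) (by linarith))
  obtain ⟨h1, h2⟩ := max_lt_iff.mp hε1
  exact ⟨γ, ε, hγ0, by linarith, ⟨h1, hε2⟩, h2, hγ1⟩

theorem exists_isQLF {α β μ γ ε : ℝ} (hβ : 0 < β) (hμ : 0 < μ) (hα0 : 0 < α) (hα1 : α < 1)
    (hγ : 0 < γ) (hε1 : β * γ ^ 2 / 4 < ε) (hε2 : ε < β * γ ^ 2 / 2) :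
    ∃ P : Matrix (Fin 3) (Fin 3) ℝ, ∀ A ∈ ({APlus α β μ γ ε, AMinus α β μ γ ε} : Set _),
      IsQLF A P := by
  have hε : 0 < ε := lt_trans (by positivity) hε1
  have hT := phaseMap_mulVec_injective (γ := γ) hα0.ne' hβ.ne' hε.ne'
  have he1 : (β * γ) ^ 2 / 4 < β * ε := by nlinarith
  have he2 : β * ε < (β * γ) ^ 2 / 2 := by nlinarith
  have hK := fun σ => companion_isQLF (σ := σ) hα0 hα1 hμ (mul_pos hβ hγ) he1 he2
  refine ⟨(phaseMap α β γ ε)ᵀ * phaseForm α μ (β * γ) (β * ε) * phaseMap α β γ ε, ?_⟩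
  rintro A (rfl | rfl)
  · exact (hK 0 (.inl rfl)).conj hT (phaseMap_mul_APlus α β μ γ ε)
  · exact (hK (α * μ) (.inr rfl)).conj hT (phaseMap_mul_AMinus α β μ γ ε)

end AgentInvitation

/-! ### Transfer to the nonlinear system and conclusion -/

namespace AgentInvitation

open SwitchedLinear

/-- Exponential stability of the switched system passes to the nonlinear system, whose solutions
are switched solutions for the signal given by the sign of `y`. -/
theorem exponentiallyStable_field {α β μ γ ε : ℝ}
    (h : SwitchedExponentiallyStable {APlus α β μ γ ε, AMinus α β μ γ ε}) :
    ExponentiallyStable (field α β μ γ ε) := by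
  obtain ⟨C, a, hC, ha, h⟩ := h
  refine ⟨C, a, hC, ha, fun u hu => ?_⟩
  refine h (fun t => if 0 ≤ u t 1 then APlus α β μ γ ε else AMinus α β μ γ ε) u
    (fun t _ => ?_) ⟨fun t ht => (hu t ht).continuousWithinAt, ∅, by simp, fun t ht _ => ?_⟩
  · split_ifs <;> simp
  · dsimp only
    have hd := hu t ht
    split_ifs with hy
    · rwa [field_eq_of_nonneg _ _ _ _ _ _ hy] at hd
    · rwa [field_eq_of_neg _ _ _ _ _ _ (not_le.mp hy)] at hd

end AgentInvitation

theorem theorem2 (α β μ : ℝ) (hβ : 0 < β) (hμ : 0 < μ) (hα : α ∈ Set.Ioo (0 : ℝ) 1) :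
    (∃ γ ε : ℝ, 0 < γ ∧ 0 < ε ∧ AgentInvitation.StableCond α β μ γ ε) ∧
    ∀ γ ε : ℝ, 0 < γ → 0 < ε → AgentInvitation.StableCond α β μ γ ε →
      (∃ P : Matrix (Fin 3) (Fin 3) ℝ,
        SwitchedLinear.IsCQLF
          {AgentInvitation.APlus α β μ γ ε, AgentInvitation.AMinus α β μ γ ε} P) ∧
      SwitchedLinear.SwitchedExponentiallyStable
        {AgentInvitation.APlus α β μ γ ε, AgentInvitation.AMinus α β μ γ ε} ∧
      SwitchedLinear.ExponentiallyStable (AgentInvitation.field α β μ γ ε) := by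
  refine ⟨AgentInvitation.exists_stableCond hβ hμ hα.1, fun γ ε hγ _ hc => ?_⟩
  obtain ⟨P, hP⟩ := AgentInvitation.exists_isQLF hβ hμ hα.1 hα.2 hγ hc.1.1 hc.1.2
  have hP' : SwitchedLinear.IsCQLF
      {AgentInvitation.APlus α β μ γ ε, AgentInvitation.AMinus α β μ γ ε} P :=
    ⟨fun A hA => (hP A hA).isHurwitz, hP⟩
  have hs := hP'.switchedExponentiallyStable (Set.toFinite _)
  exact ⟨⟨P, hP'⟩, hs, AgentInvitation.exponentiallyStable_field hs⟩
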